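/- Let $n\ge 3$ and $p\ge 1$ be integers, let $a,b\in\mathbb R$, and let $\mathcal C\subset S^{n-1}\subset\mathbb R^n$ be a finite set of unit vectors such that $x\cdot y\in\{a,b\}$ for all distinct $x,y\in\mathcal C$ (a spherical two-distance set with inner products $a$ and $b$). For $m\ge 2$ let $G_k^{(m)}$ denote the Gegenbauer polynomials defined by $G_0^{(m)}(t)=1$, $G_1^{(m)}(t)=t$ and $$G_k^{(m)}(t)=\frac{(2k+m-4)\,t\,G_{k-1}^{(m)}(t)-(k-1)\,G_{k-2}^{(m)}(t)}{k+m-3},\qquad k\ge 2.$$ For $0\le k\le p$ let $Y_k^n(u,v,t)$ be the $(p-k+1)\times(p-k+1)$ matrix with entries $$(Y_k^n(u,v,t))_{ij}=u^iv^j\,\big((1-u^2)(1-v^2)\big)^{k/2}\,G_k^{(n-1)}\!\left(\frac{t-uv}{\sqrt{(1-u^2)(1-v^2)}}\right),\qquad 0\le i,j\le p-k,$$ which are polynomials in $u,v,t$ and are understood as such when $(1-u^2)(1-v^2)=0$, and let $$S_k^n(u,v,t)=\frac16\sum_{\sigma}Y_k^n(\sigma(u,v,t)),$$ where the sum is over all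 permutations $\sigma$ of the three arguments. Consider the semidefinite program in the real variables $x_1,\dots,x_6$: find the supremum of $$1+\tfrac13(x_1+x_2)$$ subject to $$\begin{pmatrix}1&0\\0&0\end{pmatrix}+\frac13\begin{pmatrix}0&1\\1&1\end{pmatrix}(x_1+x_2)+\begin{pmatrix}0&0\\0&1\end{pmatrix}(x_3+x_4+x_5+x_6)\succeq0,$$ $$3+G_i^{(n)}(a)\,x_1+G_i^{(n)}(b)\,x_2\ge0,\qquad i=1,\dots,p,$$ $$S_i^n(1,1,1)+S_i^n(a,a,1)x_1+S_i^n(b,b,1)x_2+S_i^n(a,a,a)x_3+S_i^n(a,a,b)x_4+S_i^n(a,b,b)x_5+S_i^n(b,b,b)x_6\succeq0,\qquad i=0,1,\dots,p,$$ $$x_j\ge0,\qquad j=1,\dots,6.$$ Then $|\mathcal C|$ is at most the optimal value of this program (which is $+\infty$ if the objective is unbounded on the feasible set). -/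

import Mathlib

namespace TwoDistanceSDP

/-- The Gegenbauer polynomial `G_k^{(m)}(t)`, normalised by `G_k^{(m)}(1) = 1`, through its
three-term recurrence. -/
noncomputable def gegenbauer (m : ℕ) : ℕ → ℝ → ℝ
  | 0, _ => 1
  | 1, t => t
  | k + 2, t =>
      ((2 * ((k + 2 : ℕ) : ℝ) + (m : ℝ) - 4) * t * gegenbauer m (k + 1) t
          - (((k + 2 : ℕ) : ℝ) - 1) * gegenbauer m k t)
        / (((k + 2 : ℕ) : ℝ) + (m : ℝ) - 3)

/-- The polynomial in `(s, w)` that equals `w^{k/2} G_k^{(m)}(s / √w)` for `w > 0`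
(see `homGegenbauer_eq`). It gives that expression its value at `w = 0`. -/
noncomputable def homGegenbauer (m : ℕ) : ℕ → ℝ → ℝ → ℝ
  | 0, _, _ => 1
  | 1, s, _ => s
  | k + 2, s, w =>
      ((2 * ((k + 2 : ℕ) : ℝ) + (m : ℝ) - 4) * s * homGegenbauer m (k + 1) s w
          - (((k + 2 : ℕ) : ℝ) - 1) * w * homGegenbauer m k s w)
        / (((k + 2 : ℕ) : ℝ) + (m : ℝ) - 3)

/-- The Bachoc–Vallentin matrix `Y_k^n(u,v,t)` of size `p - k + 1`, rows and columns indexed by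
`0, …, p - k`, with entries
`u^i v^j ((1-u²)(1-v²))^{k/2} G_k^{(n-1)}((t - uv) / √((1-u²)(1-v²)))`, read as polynomials in
`u, v, t` (see `matY_apply`). -/
noncomputable def matY (n p k : ℕ) (u v t : ℝ) :
    Matrix (Fin (p - k + 1)) (Fin (p - k + 1)) ℝ :=
  Matrix.of fun i j =>
    u ^ (i : ℕ) * v ^ (j : ℕ) *
      homGegenbauer (n - 1) k (t - u * v) ((1 - u ^ 2) * (1 - v ^ 2))

/-- The symmetrised matrix `S_k^n(u,v,t) = (1/6) ∑_σ Y_k^n(σ(u,v,t))`, over all permutations `σ`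
of the three arguments. -/
noncomputable def matS (n p k : ℕ) (u v t : ℝ) :
    Matrix (Fin (p - k + 1)) (Fin (p - k + 1)) ℝ :=
  (1 / 6 : ℝ) • ∑ σ : Equiv.Perm (Fin 3),
    matY n p k (![u, v, t] (σ 0)) (![u, v, t] (σ 1)) (![u, v, t] (σ 2))

/-- The constraints of the semidefinite program; the variables `x_1, …, x_6` are
`x 0, …, x 5`. -/
structure Feasible (n p : ℕ) (a b : ℝ) (x : Fin 6 → ℝ) : Prop where
  nonneg : ∀ j, 0 ≤ x j
  psd_two :
    (!![1, 0; 0, 0] + (1 / 3 : ℝ) • (x 0 + x 1) • !![0, 1; 1, 1]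
      + (x 2 + x 3 + x 4 + x 5) • !![0, 0; 0, 1] : Matrix (Fin 2) (Fin 2) ℝ).PosSemidef
  linear : ∀ i ∈ Finset.Icc 1 p,
    0 ≤ 3 + gegenbauer n i a * x 0 + gegenbauer n i b * x 1
  psd_S : ∀ i ∈ Finset.Icc 0 p,
    (matS n p i 1 1 1 + x 0 • matS n p i a a 1 + x 1 • matS n p i b b 1
      + x 2 • matS n p i a a a + x 3 • matS n p i a a b
      + x 4 • matS n p i a b b + x 5 • matS n p i b b b).PosSemidef

/-- The optimal value `1 + (1/3) max (x_1 + x_2)` of the program, as an extended real: it is `⊤`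
when the objective is unbounded on the feasible set. -/
noncomputable def sdpValue (n p : ℕ) (a b : ℝ) : EReal :=
  ⨆ x ∈ {x : Fin 6 → ℝ | Feasible n p a b x}, ((1 + (1 / 3) * (x 0 + x 1) : ℝ) : EReal)

theorem homGegenbauer_eq (m : ℕ) {w : ℝ} (hw : 0 < w) (s : ℝ) :
    ∀ k : ℕ, homGegenbauer m k s w = w ^ ((k : ℝ) / 2) * gegenbauer m k (s / √w) := by
  have key : ∀ k : ℕ, w ^ ((k : ℝ) / 2) = √w ^ k := by
    intro k
    rw [Real.sqrt_eq_rpow, ← Real.rpow_mul_natCast hw.le]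
    congr 1
    ring
  have hr : √w ≠ 0 := (Real.sqrt_pos.2 hw).ne'
  have hsq : √w ^ 2 = w := Real.sq_sqrt hw.le
  have main : ∀ k : ℕ, homGegenbauer m k s w = √w ^ k * gegenbauer m k (s / √w) ∧
      homGegenbauer m (k + 1) s w = √w ^ (k + 1) * gegenbauer m (k + 1) (s / √w) := by
    intro k
    induction k with
    | zero =>
      refine ⟨by simp [homGegenbauer, gegenbauer], ?_⟩
      simp only [homGegenbauer, gegenbauer]
      field_simp
      ring
    | succ k ih =>
      refine ⟨ih.2, ?_⟩
      simp only [homGegenbauer, gegenbauer]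
      rw [ih.1, ih.2, mul_div_assoc']
      congr 1
      have e : √w ^ (k + 1 + 1) * (s / √w) = √w ^ (k + 1) * s := by
        field_simp
        ring
      have e' : √w ^ (k + 1 + 1) = w * √w ^ k := by
        linear_combination √w ^ k * hsq
      linear_combination (-(2 * ((k + 2 : ℕ) : ℝ) + (m : ℝ) - 4)
          * gegenbauer m (k + 1) (s / √w)) * e
        + ((((k + 2 : ℕ) : ℝ) - 1) * gegenbauer m k (s / √w)) * e'
  intro k
  rw [key, (main k).1]

/-- The entries of `Y_k^n` in their usual form, wherever that form involves no division by
zero. -/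
theorem matY_apply (n p k : ℕ) (u v t : ℝ) (h : 0 < (1 - u ^ 2) * (1 - v ^ 2))
    (i j : Fin (p - k + 1)) :
    matY n p k u v t i j =
      u ^ (i : ℕ) * v ^ (j : ℕ) * ((1 - u ^ 2) * (1 - v ^ 2)) ^ ((k : ℝ) / 2) *
        gegenbauer (n - 1) k ((t - u * v) / √((1 - u ^ 2) * (1 - v ^ 2))) := by
  rw [mul_assoc (u ^ (i : ℕ) * v ^ (j : ℕ)), ← homGegenbauer_eq (n - 1) h]
  rfl

end TwoDistanceSDP

/-! For nonempty `C` with N points, count ordered pairs and triples of distinct points by their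
inner products and divide by N (pair counts also get a factor 3). The resulting point is feasible
and its objective is exactly N. Pairs are split into "inner product a" and "not a", so nothing is
counted twice if a = b.

The 2×2 matrix becomes the rank-one matrix of (1, N-1). The linear constraints are Schoenberg's
inequality, that the sum of G_i(x · y) over pairs is nonnegative. The matrix constraints are those
of Bachoc and Vallentin: for fixed e in `C`, Schoenberg's inequality is applied in dimension n-1 to
the projections onto the complement of e, and then summed over e.

Both rest on positivity of the Gegenbauer kernel, proved algebraically in `sum_zonal_nonneg`. The
zonal polynomial Z_y is harmonic and equals c (x · y)^k modulo |x|², with c > 0. Since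
multiplication by |x|² is adjoint to the Laplacian in the Fischer product, pairing Z_y with Z_z
gives c k! Z_z(y), so the kernel is a Gram matrix up to a positive factor. -/

namespace TwoDistanceSDP

/-! ### The Fischer inner product and its adjoint pairs. -/

open MvPolynomial in
/-- The Fischer inner product on polynomials, in which distinct monomials are orthogonal and
`X^α` has squared norm `α!`. -/
noncomputable def fischer (σ : Type*) [Fintype σ] :
    MvPolynomial σ ℝ →ₗ[ℝ] MvPolynomial σ ℝ →ₗ[ℝ] ℝ :=
  (basisMonomials σ ℝ).constr ℝ fun α => ((∏ i, (α i).factorial : ℕ) : ℝ) • lcoeff ℝ α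

section Fischer

open MvPolynomial

variable {σ : Type*} [Fintype σ]

theorem fischer_monomial (α : σ →₀ ℕ) (c : ℝ) (Q : MvPolynomial σ ℝ) :
    fischer σ (monomial α c) Q = c * ((∏ i, (α i).factorial : ℕ) : ℝ) * coeff α Q := by
  have h : monomial α c = c • basisMonomials σ ℝ α := by
    simp [coe_basisMonomials, smul_monomial]
  rw [h, map_smul, fischer, Module.Basis.constr_basis]
  simp [lcoeff, mul_assoc]

theorem fischer_self_nonneg (P : MvPolynomial σ ℝ) : 0 ≤ fischer σ P P := by
  have h : fischer σ P P = ∑ α ∈ P.support,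
      ((∏ i, (α i).factorial : ℕ) : ℝ) * coeff α P ^ 2 := by
    conv_lhs => arg 1; rw [P.as_sum]
    rw [map_sum, LinearMap.sum_apply]
    refine Finset.sum_congr rfl fun α _ => ?_
    rw [fischer_monomial]
    ring
  rw [h]
  positivity

theorem fischer_X_mul (i : σ) (P Q : MvPolynomial σ ℝ) :
    fischer σ (X i * P) Q = fischer σ P (pderiv i Q) := by
  classical
  induction P using MvPolynomial.induction_on' with
  | add p q hp hq => simp [mul_add, hp, hq]
  | monomial α c =>
    rw [X, monomial_mul, one_mul, fischer_monomial, fischer_monomial]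
    induction Q using MvPolynomial.induction_on' with
    | add p q hp hq => simp only [map_add, coeff_add, mul_add, hp, hq]
    | monomial β d =>
      rw [pderiv_monomial, coeff_monomial, coeff_monomial]
      by_cases h : β = Finsupp.single i 1 + α
      · subst h
        have hf : (∏ j, ((Finsupp.single i 1 + α : σ →₀ ℕ) j).factorial)
            = (α i + 1) * ∏ j, (α j).factorial := by
          rw [← Finset.mul_prod_erase _ _ (Finset.mem_univ i),
            ← Finset.mul_prod_erase _ (fun j => (α j).factorial) (Finset.mem_univ i), ← mul_assoc]
          congr 1
          · simp [add_comm 1, Nat.factorial_succ]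
          · refine Finset.prod_congr rfl fun j hj => ?_
            simp [(Finset.ne_of_mem_erase hj).symm]
        rw [hf]
        simp
        ring
      · rw [if_neg h]
        -- Subtraction is truncated: this equality can hold without `h` only if β i = 0, and then
        -- the derivative vanishes.
        by_cases h' : β - Finsupp.single i 1 = α
        · have hi : β i = 0 := by
            by_contra hi
            apply h
            ext j
            have := DFunLike.congr_fun h' j
            by_cases hj : j = i
            · subst hj
              simp at this ⊢
              omega
            · simpa [Finsupp.single_apply, Ne.symm hj] using this
          simp [hi]
        · rw [if_neg h']
          simp

/-- The linear form `x ↦ x · y`. -/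
noncomputable def linForm (y : σ → ℝ) : MvPolynomial σ ℝ := ∑ i, C (y i) * X i

/-- The derivation `y · ∇`. -/
noncomputable def dirDeriv (y : σ → ℝ) : Derivation ℝ (MvPolynomial σ ℝ) (MvPolynomial σ ℝ) :=
  ∑ i, y i • pderiv i

/-- The quadratic form `x ↦ x · x`. -/
noncomputable def sqForm (σ : Type*) [Fintype σ] : MvPolynomial σ ℝ := ∑ i, X i * X i

/-- The Laplace operator. -/
noncomputable def laplacian (σ : Type*) [Fintype σ] :
    MvPolynomial σ ℝ →ₗ[ℝ] MvPolynomial σ ℝ :=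
  ∑ i, (pderiv i).toLinearMap ∘ₗ (pderiv i).toLinearMap

theorem dirDeriv_apply (y : σ → ℝ) (Q : MvPolynomial σ ℝ) :
    dirDeriv y Q = ∑ i, y i • pderiv i Q := by
  classical
  have h (s : Finset σ) : (∑ i ∈ s, y i • pderiv i : Derivation ℝ (MvPolynomial σ ℝ) _) Q
      = ∑ i ∈ s, y i • pderiv i Q := by
    induction s using Finset.induction_on with
    | empty => simp
    | insert a s ha ih => simp [Finset.sum_insert ha, ih]
  exact h _

theorem laplacian_apply (Q : MvPolynomial σ ℝ) :
    laplacian σ Q = ∑ i, pderiv i (pderiv i Q) := by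
  simp [laplacian, LinearMap.sum_apply]

theorem fischer_linForm_mul (y : σ → ℝ) (P Q : MvPolynomial σ ℝ) :
    fischer σ (linForm y * P) Q = fischer σ P (dirDeriv y Q) := by
  rw [linForm, Finset.sum_mul, map_sum, LinearMap.sum_apply, dirDeriv_apply, map_sum]
  refine Finset.sum_congr rfl fun i _ => ?_
  rw [mul_assoc, ← smul_eq_C_mul, map_smul, LinearMap.smul_apply, fischer_X_mul, map_smul]

theorem fischer_sqForm_mul (P Q : MvPolynomial σ ℝ) :
    fischer σ (sqForm σ * P) Q = fischer σ P (laplacian σ Q) := by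
  rw [sqForm, Finset.sum_mul, map_sum, LinearMap.sum_apply, laplacian_apply, map_sum]
  refine Finset.sum_congr rfl fun i _ => ?_
  rw [mul_assoc, fischer_X_mul, fischer_X_mul]

theorem dirDeriv_isHomogeneous (y : σ → ℝ) {Q : MvPolynomial σ ℝ} {k : ℕ}
    (hQ : Q.IsHomogeneous (k + 1)) : (dirDeriv y Q).IsHomogeneous k := by
  rw [dirDeriv_apply]
  refine IsHomogeneous.sum _ _ _ fun i _ => ?_
  rw [smul_eq_C_mul]
  simpa using (isHomogeneous_C σ (y i)).mul (hQ.pderiv (i := i))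

/-- Pairing with a power of a linear form evaluates homogeneous polynomials. -/
theorem fischer_linForm_pow (y : σ → ℝ) (k : ℕ) {Q : MvPolynomial σ ℝ}
    (hQ : Q.IsHomogeneous k) : fischer σ (linForm y ^ k) Q = k.factorial * eval y Q := by
  induction k generalizing Q with
  | zero =>
    have h1 : (1 : MvPolynomial σ ℝ) = monomial 0 1 := rfl
    have h2 : Q = C (coeff 0 Q) :=
      totalDegree_eq_zero_iff_eq_C.1 (Nat.le_zero.1 hQ.totalDegree_le)
    rw [pow_zero, h1, fischer_monomial]
    conv_rhs => rw [h2]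
    simp
  | succ k ih =>
    rw [pow_succ', fischer_linForm_mul, ih (dirDeriv_isHomogeneous y hQ), dirDeriv_apply]
    -- Euler's identity at y supplies the factor k + 1.
    have h := congrArg (eval y) hQ.sum_X_mul_pderiv
    simp only [map_sum, map_mul, eval_X, smul_eval, nsmul_eq_mul, map_natCast] at h ⊢
    rw [h, Nat.factorial_succ]
    push_cast
    ring

end Fischer

/-! ### Zonal harmonics as a reproducing kernel. -/

section Zonal

open MvPolynomial

variable {σ : Type*} [Fintype σ]

theorem dirDeriv_linForm (y z : σ → ℝ) : dirDeriv y (linForm z) = C (y ⬝ᵥ z) := by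
  classical
  rw [dirDeriv_apply]
  simp [linForm, pderiv_X, Pi.single_apply, dotProduct, smul_eq_C_mul]

theorem dirDeriv_sqForm (y : σ → ℝ) : dirDeriv y (sqForm σ) = 2 * linForm y := by
  classical
  rw [dirDeriv_apply, linForm, Finset.mul_sum]
  refine Finset.sum_congr rfl fun i _ => ?_
  simp [sqForm, pderiv_X, Pi.single_apply, smul_eq_C_mul, Finset.sum_add_distrib]
  ring

theorem laplacian_linForm_mul (y : σ → ℝ) (Q : MvPolynomial σ ℝ) :
    laplacian σ (linForm y * Q) = 2 * dirDeriv y Q + linForm y * laplacian σ Q := by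
  classical
  rw [laplacian_apply, laplacian_apply, dirDeriv_apply, Finset.mul_sum, Finset.mul_sum,
    ← Finset.sum_add_distrib]
  refine Finset.sum_congr rfl fun i _ => ?_
  have h : pderiv i (linForm y) = C (y i) := by
    simp [linForm, pderiv_X, Pi.single_apply]
  simp only [pderiv_mul, map_add, h, pderiv_C, smul_eq_C_mul]
  ring

/-- Leibniz: Δ|x|² is twice the dimension, and the cross term 4 x · ∇Q is 4kQ by Euler's identity.
-/
theorem laplacian_sqForm_mul {k : ℕ} {Q : MvPolynomial σ ℝ} (hQ : Q.IsHomogeneous k) :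
    laplacian σ (sqForm σ * Q)
      = C (2 * (Fintype.card σ : ℝ) + 4 * k) * Q + sqForm σ * laplacian σ Q := by
  classical
  have h (i : σ) : pderiv i (sqForm σ) = 2 * X i := by
    simp [sqForm, pderiv_X, Pi.single_apply, Finset.sum_add_distrib]
    ring
  have h' (i : σ) : pderiv i (pderiv i (sqForm σ * Q))
      = 2 * Q + 4 * (X i * pderiv i Q) + sqForm σ * pderiv i (pderiv i Q) := by
    have h2 : pderiv i (2 : MvPolynomial σ ℝ) = 0 := by
      rw [show (2 : MvPolynomial σ ℝ) = C 2 from (map_ofNat C 2).symm, pderiv_C]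
    simp only [pderiv_mul, map_add, h, h2, pderiv_X_self]
    ring
  simp only [laplacian_apply, h', Finset.sum_add_distrib, ← Finset.mul_sum,
    hQ.sum_X_mul_pderiv]
  simp [show (C 2 : MvPolynomial σ ℝ) = 2 from map_ofNat C 2,
    show (C 4 : MvPolynomial σ ℝ) = 4 from map_ofNat C 4]
  ring

/-- The zonal polynomial `x ↦ |x|^k |y|^k G_k^{(m)}(x · y / (|x| |y|))` in dimension `m`. -/
noncomputable def zonal (y : σ → ℝ) : ℕ → MvPolynomial σ ℝ
  | 0 => 1
  | 1 => linForm y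
  | k + 2 => C (((k : ℝ) + Fintype.card σ - 1)⁻¹) *
      (C (2 * (k : ℝ) + Fintype.card σ) * linForm y * zonal y (k + 1)
        - C ((k + 1 : ℝ) * (y ⬝ᵥ y)) * sqForm σ * zonal y k)

theorem eval_zonal (x y : σ → ℝ) (k : ℕ) :
    eval x (zonal y k) = homGegenbauer (Fintype.card σ) k (x ⬝ᵥ y) ((x ⬝ᵥ x) * (y ⬝ᵥ y)) := by
  have hl : eval x (linForm y) = x ⬝ᵥ y := by simp [linForm, dotProduct, mul_comm]
  have hs : eval x (sqForm σ) = x ⬝ᵥ x := by simp [sqForm, dotProduct]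
  induction k using Nat.twoStepInduction with
  | zero => simp [zonal, homGegenbauer]
  | one => simpa [zonal, homGegenbauer] using hl
  | more k ih1 ih2 =>
    simp only [zonal, homGegenbauer, map_mul, map_sub, eval_C, hl, hs, ih1, ih2]
    rw [div_eq_inv_mul]
    push_cast
    ring_nf

theorem linForm_isHomogeneous (y : σ → ℝ) : (linForm y).IsHomogeneous 1 :=
  IsHomogeneous.sum _ _ _ fun i _ => by
    simpa using (isHomogeneous_C σ (y i)).mul (isHomogeneous_X ℝ i)

theorem sqForm_isHomogeneous : (sqForm σ).IsHomogeneous 2 :=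
  IsHomogeneous.sum _ _ _ fun i _ => (isHomogeneous_X ℝ i).mul (isHomogeneous_X ℝ i)

theorem zonal_isHomogeneous (y : σ → ℝ) (k : ℕ) : (zonal y k).IsHomogeneous k := by
  induction k using Nat.twoStepInduction with
  | zero => exact isHomogeneous_one σ ℝ
  | one => exact linForm_isHomogeneous y
  | more k ih1 ih2 =>
    rw [zonal]
    have h1 := ((isHomogeneous_C σ (2 * (k : ℝ) + Fintype.card σ)).mul
      (linForm_isHomogeneous y)).mul ih2
    have h2 := ((isHomogeneous_C σ ((k + 1 : ℝ) * (y ⬝ᵥ y))).mul sqForm_isHomogeneous).mul ih1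
    rw [show 0 + 1 + (k + 1) = k + 2 by omega] at h1
    rw [show 0 + 2 + k = k + 2 by omega] at h2
    simpa using (isHomogeneous_C σ _).mul (h1.sub h2)

/-- The recurrence for `zonal`, with denominators cleared. -/
theorem zonal_recurrence (hm : 2 ≤ Fintype.card σ) (y : σ → ℝ) (k : ℕ) :
    ((k : MvPolynomial σ ℝ) + (Fintype.card σ : MvPolynomial σ ℝ) - 1) * zonal y (k + 2)
      = (2 * (k : MvPolynomial σ ℝ) + (Fintype.card σ : MvPolynomial σ ℝ)) * linForm y * zonal y (k + 1)
        - ((k : MvPolynomial σ ℝ) + 1) * C (y ⬝ᵥ y) * sqForm σ * zonal y k := by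
  have hm' : (2 : ℝ) ≤ Fintype.card σ := by exact_mod_cast hm
  have h0 : (k : ℝ) + Fintype.card σ - 1 ≠ 0 := by
    have : (0 : ℝ) ≤ k := k.cast_nonneg
    linarith
  have h1 : (k : MvPolynomial σ ℝ) + (Fintype.card σ : MvPolynomial σ ℝ) - 1 = C ((k : ℝ) + Fintype.card σ - 1) := by
    simp
  have h2 : (C 2 : MvPolynomial σ ℝ) = 2 := map_ofNat C 2
  rw [zonal, h1, ← mul_assoc, ← C_mul, mul_inv_cancel₀ h0, C_1, one_mul]
  simp [h2]

theorem zonal_coeff_ne_zero (hm : 2 ≤ Fintype.card σ) (k : ℕ) :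
    (k : MvPolynomial σ ℝ) + (Fintype.card σ : MvPolynomial σ ℝ) - 1 ≠ 0 := by
  have h : (k : MvPolynomial σ ℝ) + (Fintype.card σ : MvPolynomial σ ℝ) - 1
      = ((k + Fintype.card σ - 1 : ℕ) : MvPolynomial σ ℝ) := by
    rw [Nat.cast_sub (by omega)]
    push_cast
    ring
  rw [h, Nat.cast_ne_zero]
  omega

theorem dirDeriv_natCast (y : σ → ℝ) (k : ℕ) : dirDeriv y (k : MvPolynomial σ ℝ) = 0 :=
  (dirDeriv y).map_natCast k

theorem dirDeriv_zonal_recurrence (hm : 2 ≤ Fintype.card σ) (y : σ → ℝ) (k : ℕ) :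
    ((k : MvPolynomial σ ℝ) + (Fintype.card σ : MvPolynomial σ ℝ) - 1) * dirDeriv y (zonal y (k + 2))
      = (2 * (k : MvPolynomial σ ℝ) + (Fintype.card σ : MvPolynomial σ ℝ))
          * (linForm y * dirDeriv y (zonal y (k + 1)) + zonal y (k + 1) * C (y ⬝ᵥ y))
        - ((k : MvPolynomial σ ℝ) + 1) * C (y ⬝ᵥ y)
          * (sqForm σ * dirDeriv y (zonal y k) + zonal y k * (2 * linForm y)) := by
  have hC (c : ℝ) : dirDeriv y (C c) = 0 := (dirDeriv y).map_algebraMap c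
  have h2 : dirDeriv y 2 = 0 := dirDeriv_natCast y 2
  have h := congrArg (dirDeriv y) (zonal_recurrence hm y k)
  simp only [Derivation.leibniz, map_sub, map_add, hC, h2, dirDeriv_linForm, dirDeriv_sqForm,
    smul_eq_mul, mul_zero, add_zero, Derivation.map_one_eq_zero, dirDeriv_natCast,
    sub_zero] at h
  linear_combination h

/-- Evaluates the cross term that appears when the Laplacian is applied to the recurrence. -/
theorem dirDeriv_zonal (hm : 2 ≤ Fintype.card σ) (y : σ → ℝ) (k : ℕ) :
    dirDeriv y (zonal y (k + 1)) = ((k : MvPolynomial σ ℝ) + 1) * C (y ⬝ᵥ y) * zonal y k := by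
  induction k using Nat.twoStepInduction with
  | zero => simp [zonal, dirDeriv_linForm]
  | one =>
    apply mul_left_cancel₀ (zonal_coeff_ne_zero hm 0)
    rw [dirDeriv_zonal_recurrence hm]
    simp only [zonal, dirDeriv_linForm, Derivation.map_one_eq_zero]
    push_cast
    ring
  | more k ih1 ih2 =>
    apply mul_left_cancel₀ (zonal_coeff_ne_zero hm (k + 1))
    rw [dirDeriv_zonal_recurrence hm, ih2, ih1]
    push_cast
    linear_combination (-((k : MvPolynomial σ ℝ) + 2) * C (y ⬝ᵥ y)) * zonal_recurrence hm y k

/-- With m the dimension, the linear-form term of the recurrence contributes 2(2k + m)(k + 1)|y|²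
Z_k, which cancels against (k + 1)|y|²(2m + 4k) Z_k from the |x|² term. -/
theorem laplacian_zonal (hm : 2 ≤ Fintype.card σ) (y : σ → ℝ) (k : ℕ) :
    laplacian σ (zonal y k) = 0 := by
  induction k using Nat.twoStepInduction with
  | zero => simp [laplacian_apply, zonal]
  | one =>
    have h := laplacian_linForm_mul y 1
    simpa [laplacian_apply, Derivation.map_one_eq_zero, zonal] using h
  | more k ih1 ih2 =>
    apply mul_left_cancel₀ (zonal_coeff_ne_zero hm k)
    have hC (c : ℝ) (Q : MvPolynomial σ ℝ) : laplacian σ (C c * Q) = C c * laplacian σ Q := by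
      rw [← smul_eq_C_mul, map_smul, smul_eq_C_mul]
    have h2 : (C 2 : MvPolynomial σ ℝ) = 2 := map_ofNat C 2
    have h4 : (C 4 : MvPolynomial σ ℝ) = 4 := map_ofNat C 4
    have h := congrArg (laplacian σ) (zonal_recurrence hm y k)
    have e1 : (k : MvPolynomial σ ℝ) + (Fintype.card σ : MvPolynomial σ ℝ) - 1
        = C ((k : ℝ) + Fintype.card σ - 1) := by simp
    have e2 : 2 * (k : MvPolynomial σ ℝ) + (Fintype.card σ : MvPolynomial σ ℝ)
        = C (2 * (k : ℝ) + Fintype.card σ) := by simp [h2]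
    have e3 : ((k : MvPolynomial σ ℝ) + 1) * C (y ⬝ᵥ y) = C ((k + 1 : ℝ) * (y ⬝ᵥ y)) := by simp
    rw [e1, e2, e3, mul_assoc, mul_assoc, hC, map_sub (laplacian σ), hC, hC, laplacian_linForm_mul,
      laplacian_sqForm_mul (zonal_isHomogeneous y k), ih1, ih2, dirDeriv_zonal hm] at h
    rw [e1, h]
    simp only [C_mul, C_add, map_natCast, map_one, h2, h4]
    ring

/-- A zonal polynomial is a positive multiple of a power of a linear form, modulo `sqForm`. -/
theorem zonal_leading (hm : 2 ≤ Fintype.card σ) (k : ℕ) :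
    ∃ c : ℝ, 0 < c ∧ ∀ y : σ → ℝ, ∃ R, zonal y k = C c * linForm y ^ k + sqForm σ * R := by
  have hm' : (2 : ℝ) ≤ Fintype.card σ := by exact_mod_cast hm
  induction k using Nat.twoStepInduction with
  | zero => exact ⟨1, one_pos, fun y => ⟨0, by simp [zonal]⟩⟩
  | one => exact ⟨1, one_pos, fun y => ⟨0, by simp [zonal]⟩⟩
  | more k _ ih =>
    obtain ⟨c, hc, h⟩ := ih
    have h0 : (0 : ℝ) < (k : ℝ) + Fintype.card σ - 1 := by
      have : (0 : ℝ) ≤ k := k.cast_nonneg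
      linarith
    refine ⟨((k : ℝ) + Fintype.card σ - 1)⁻¹ * (2 * (k : ℝ) + Fintype.card σ) * c,
      by positivity, fun y => ?_⟩
    obtain ⟨R, hR⟩ := h y
    refine ⟨C (((k : ℝ) + Fintype.card σ - 1)⁻¹) *
      (C (2 * (k : ℝ) + Fintype.card σ) * linForm y * R
        - C ((k + 1 : ℝ) * (y ⬝ᵥ y)) * zonal y k), ?_⟩
    rw [zonal, hR]
    simp only [C_mul]
    ring

/-- The zonal kernel is positive semidefinite. -/
theorem sum_zonal_nonneg (hm : 2 ≤ Fintype.card σ) (k : ℕ) {ι : Type*} (s : Finset ι)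
    (f : ι → ℝ) (x : ι → σ → ℝ) :
    0 ≤ ∑ i ∈ s, ∑ j ∈ s, f i * f j * eval (x i) (zonal (x j) k) := by
  obtain ⟨c, hc, h⟩ := zonal_leading hm k
  -- Reproducing property: the remainder `sqForm σ * R` pairs to zero because `zonal z k` is
  -- harmonic.
  have key (y z : σ → ℝ) :
      fischer σ (zonal y k) (zonal z k) = c * k.factorial * eval y (zonal z k) := by
    obtain ⟨R, hR⟩ := h y
    rw [hR, map_add, LinearMap.add_apply, fischer_sqForm_mul, laplacian_zonal hm, map_zero,
      add_zero, ← smul_eq_C_mul, map_smul, LinearMap.smul_apply,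
      fischer_linForm_pow y k (zonal_isHomogeneous z k), smul_eq_mul, mul_assoc]
  have hpos := fischer_self_nonneg (∑ i ∈ s, f i • zonal (x i) k)
  have e : fischer σ (∑ i ∈ s, f i • zonal (x i) k) (∑ i ∈ s, f i • zonal (x i) k)
      = c * k.factorial * ∑ i ∈ s, ∑ j ∈ s, f i * f j * eval (x i) (zonal (x j) k) := by
    simp only [map_sum, LinearMap.sum_apply, map_smul, LinearMap.smul_apply, smul_eq_mul, key,
      Finset.mul_sum]
    rw [Finset.sum_comm]
    refine Finset.sum_congr rfl fun i _ => Finset.sum_congr rfl fun j _ => ?_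
    ring
  rw [e] at hpos
  exact nonneg_of_mul_nonneg_right hpos (by positivity)

end Zonal

/-! ### Kernels on Euclidean spaces and on the sphere. -/

/-- Positive semidefiniteness of the kernel `homGegenbauer` on a Euclidean space. -/
theorem sum_homGegenbauer_nonneg {E : Type*} [NormedAddCommGroup E] [InnerProductSpace ℝ E]
    [FiniteDimensional ℝ E] (hE : 2 ≤ Module.finrank ℝ E) (k : ℕ) {ι : Type*} (s : Finset ι)
    (f : ι → ℝ) (x : ι → E) :
    0 ≤ ∑ i ∈ s, ∑ j ∈ s, f i * f j * homGegenbauer (Module.finrank ℝ E) k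
      (inner ℝ (x i) (x j)) (inner ℝ (x i) (x i) * inner ℝ (x j) (x j)) := by
  have h := sum_zonal_nonneg (σ := Fin (Module.finrank ℝ E)) (by simpa using hE) k s f
    fun i => ⇑((stdOrthonormalBasis ℝ E).repr (x i))
  have e (u v : E) : (⇑((stdOrthonormalBasis ℝ E).repr u)) ⬝ᵥ
      (⇑((stdOrthonormalBasis ℝ E).repr v)) = inner ℝ u v := by
    rw [← (stdOrthonormalBasis ℝ E).repr.inner_map_map u v]
    simp only [PiLp.inner_apply, dotProduct, RCLike.inner_apply, conj_trivial, mul_comm]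
  simpa only [eval_zonal, e, Fintype.card_fin] using h

theorem homGegenbauer_one_right (m k : ℕ) (s : ℝ) : homGegenbauer m k s 1 = gegenbauer m k s := by
  simp [homGegenbauer_eq m one_pos]

theorem gegenbauer_one {m : ℕ} (hm : 2 ≤ m) (k : ℕ) : gegenbauer m k 1 = 1 := by
  have hm' : (2 : ℝ) ≤ m := by exact_mod_cast hm
  induction k using Nat.twoStepInduction with
  | zero => rfl
  | one => rfl
  | more k ih1 ih2 =>
    have : (0 : ℝ) ≤ k := k.cast_nonneg
    rw [gegenbauer, ih1, ih2, div_eq_one_iff_eq (by push_cast; linarith)]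
    ring

/-- The kernel on the unit sphere obtained by projecting along a unit vector `e`. -/
theorem sum_homGegenbauer_proj_nonneg {n : ℕ} (hn : 3 ≤ n) (k : ℕ)
    {e : EuclideanSpace ℝ (Fin n)} (he : ‖e‖ = 1) (s : Finset (EuclideanSpace ℝ (Fin n)))
    (hs : ∀ x ∈ s, ‖x‖ = 1) (f : EuclideanSpace ℝ (Fin n) → ℝ) :
    0 ≤ ∑ x ∈ s, ∑ y ∈ s, f x * f y * homGegenbauer (n - 1) k
      (inner ℝ x y - inner ℝ e x * inner ℝ e y)
      ((1 - inner ℝ e x ^ 2) * (1 - inner ℝ e y ^ 2)) := by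
  have he0 : e ≠ 0 := by
    rintro rfl
    simp at he
  have : Fact (Module.finrank ℝ (EuclideanSpace ℝ (Fin n)) = (n - 1) + 1) :=
    ⟨by rw [finrank_euclideanSpace_fin]; omega⟩
  have hd : Module.finrank ℝ (ℝ ∙ e)ᗮ = n - 1 := Submodule.finrank_orthogonal_span_singleton he0
  have hmem (x : EuclideanSpace ℝ (Fin n)) : x - inner ℝ e x • e ∈ (ℝ ∙ e)ᗮ := by
    rw [Submodule.mem_orthogonal_singleton_iff_inner_right, inner_sub_right, inner_smul_right,
      real_inner_self_eq_norm_sq, he]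
    simp
  -- The complement has dimension n - 1 ≥ 2. The homogenised kernel needs no normalised vectors, so
  -- x = ±e, whose projection is 0, is no exception.
  have h := sum_homGegenbauer_nonneg (E := (ℝ ∙ e)ᗮ) (by omega) k s f
    fun x => ⟨x - inner ℝ e x • e, hmem x⟩
  have hin (x y : EuclideanSpace ℝ (Fin n)) :
      inner ℝ (x - inner ℝ e x • e) (y - inner ℝ e y • e)
        = inner ℝ x y - inner ℝ e x * inner ℝ e y := by
    simp only [inner_sub_left, inner_sub_right, inner_smul_left, inner_smul_right,
      real_inner_self_eq_norm_sq, he, real_inner_comm e x, conj_trivial]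
    ring
  rw [hd] at h
  simp only [Submodule.coe_inner, hin] at h
  refine h.trans_eq (Finset.sum_congr rfl fun x hx => Finset.sum_congr rfl fun y hy => ?_)
  rw [real_inner_self_eq_norm_sq, real_inner_self_eq_norm_sq, hs x hx, hs y hy]
  ring_nf

/-! ### The Bachoc–Vallentin matrix inequality. -/

theorem matS_eq (n p k : ℕ) (u v t : ℝ) :
    matS n p k u v t = (1 / 6 : ℝ) • (matY n p k u v t + matY n p k u t v + matY n p k v u t
      + matY n p k v t u + matY n p k t u v + matY n p k t v u) := by
  have h : (Finset.univ : Finset (Equiv.Perm (Fin 3))) =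
      {1, Equiv.swap 1 2, Equiv.swap 0 1, Equiv.swap 0 1 * Equiv.swap 1 2,
        Equiv.swap 1 2 * Equiv.swap 0 1, Equiv.swap 0 2} := by decide
  rw [matS, h]
  congr 1
  repeat rw [Finset.sum_insert (by decide)]
  rw [Finset.sum_singleton]
  have e1 : (Equiv.swap (0 : Fin 3) 2) 1 = 1 := by decide
  have e2 : (Equiv.swap (1 : Fin 3) 2) 0 = 0 := by decide
  have e3 : (Equiv.swap (0 : Fin 3) 1) 2 = 2 := by decide
  simp [e1, e2, e3, add_assoc]

theorem matS_swap_left (n p k : ℕ) (u v t : ℝ) : matS n p k u v t = matS n p k v u t := by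
  rw [matS_eq, matS_eq]
  congr 1
  abel

theorem matS_swap_right (n p k : ℕ) (u v t : ℝ) : matS n p k u v t = matS n p k u t v := by
  rw [matS_eq, matS_eq]
  congr 1
  abel

section PosSemidef

variable {n : ℕ} {C : Finset (EuclideanSpace ℝ (Fin n))}

theorem matY_transpose (p k : ℕ) (u v t : ℝ) :
    (matY n p k u v t).transpose = matY n p k v u t := by
  ext i j
  simp only [matY, Matrix.transpose_apply, Matrix.of_apply]
  ring_nf

/-- The quadratic form at v is the projected kernel sum with weights f(x) = ∑ v_i (e · x)^i. -/
theorem sum_matY_posSemidef (hn : 3 ≤ n) (p k : ℕ) (hunit : ∀ x ∈ C, ‖x‖ = 1)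
    {e : EuclideanSpace ℝ (Fin n)} (he : ‖e‖ = 1) :
    (∑ x ∈ C, ∑ y ∈ C, matY n p k (inner ℝ e x) (inner ℝ e y) (inner ℝ x y)).PosSemidef := by
  refine .of_dotProduct_mulVec_nonneg ?_ fun v => ?_
  · rw [Matrix.IsHermitian, Matrix.conjTranspose_eq_transpose_of_trivial]
    simp only [Matrix.transpose_sum, matY_transpose]
    rw [Finset.sum_comm]
    simp only [real_inner_comm]
  · have h := sum_homGegenbauer_proj_nonneg hn k he C hunit
      fun x => ∑ i, v i * inner ℝ e x ^ (i : ℕ)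
    refine h.trans_eq ?_
    simp only [Matrix.sum_mulVec, dotProduct_sum]
    refine Finset.sum_congr rfl fun x _ => Finset.sum_congr rfl fun y _ => ?_
    simp only [dotProduct, Matrix.mulVec, matY, Matrix.of_apply, Finset.mul_sum, Finset.sum_mul,
      star_trivial]
    rw [Finset.sum_comm]
    refine Finset.sum_congr rfl fun i _ => Finset.sum_congr rfl fun j _ => ?_
    ring

/-- Permuting the arguments amounts to renaming x, y, z, which all range over `C`; so symmetrising
leaves the triple sum of `matY` unchanged. -/
theorem sum_matS_posSemidef (hn : 3 ≤ n) (p k : ℕ) (hunit : ∀ x ∈ C, ‖x‖ = 1) :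
    (∑ x ∈ C, ∑ y ∈ C, ∑ z ∈ C,
      matS n p k (inner ℝ x y) (inner ℝ x z) (inner ℝ y z)).PosSemidef := by
  set h : EuclideanSpace ℝ (Fin n) → EuclideanSpace ℝ (Fin n) → EuclideanSpace ℝ (Fin n) →
    Matrix (Fin (p - k + 1)) (Fin (p - k + 1)) ℝ :=
    fun x y z => matY n p k (inner ℝ x y) (inner ℝ x z) (inner ℝ y z) with hh
  have hS (x y z : EuclideanSpace ℝ (Fin n)) :
      matS n p k (inner ℝ x y) (inner ℝ x z) (inner ℝ y z)
        = (1 / 6 : ℝ) • (h x y z + h y x z + h x z y + h z x y + h y z x + h z y x) := by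
    rw [matS_eq]
    simp only [hh, real_inner_comm x y, real_inner_comm x z, real_inner_comm y z]
  have s1 (h : EuclideanSpace ℝ (Fin n) → EuclideanSpace ℝ (Fin n) → EuclideanSpace ℝ (Fin n) →
      Matrix (Fin (p - k + 1)) (Fin (p - k + 1)) ℝ) :
      ∑ x ∈ C, ∑ y ∈ C, ∑ z ∈ C, h y x z = ∑ x ∈ C, ∑ y ∈ C, ∑ z ∈ C, h x y z :=
    Finset.sum_comm
  have s2 (h : EuclideanSpace ℝ (Fin n) → EuclideanSpace ℝ (Fin n) → EuclideanSpace ℝ (Fin n) →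
      Matrix (Fin (p - k + 1)) (Fin (p - k + 1)) ℝ) :
      ∑ x ∈ C, ∑ y ∈ C, ∑ z ∈ C, h x z y = ∑ x ∈ C, ∑ y ∈ C, ∑ z ∈ C, h x y z :=
    Finset.sum_congr rfl fun _ _ => Finset.sum_comm
  have key : ∑ x ∈ C, ∑ y ∈ C, ∑ z ∈ C,
      matS n p k (inner ℝ x y) (inner ℝ x z) (inner ℝ y z)
        = ∑ x ∈ C, ∑ y ∈ C, ∑ z ∈ C, h x y z := by
    simp only [hS, ← Finset.smul_sum, Finset.sum_add_distrib]
    have h3 := (s2 fun x y z => h y x z).trans (s1 h)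
    have h4 := (s1 fun x y z => h x z y).trans (s2 h)
    have h5 := (s1 fun x y z => h z x y).trans h3
    rw [s1 h, s2 h, h3, h4, h5]
    module
  rw [key]
  exact Matrix.posSemidef_sum _ fun e he => sum_matY_posSemidef hn p k hunit (hunit e he)

end PosSemidef

/-! ### Pair and triple counts. -/

section Counting

variable {E : Type*} [DecidableEq E]

/-- Indicator of the pairs of distinct points whose inner product is `a`. -/
noncomputable def indA (g : E → E → ℝ) (a : ℝ) (x y : E) : ℝ :=
  open Classical in if x ≠ y ∧ g x y = a then 1 else 0

/-- Indicator of the pairs of distinct points whose inner product is not `a`. -/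
noncomputable def indB (g : E → E → ℝ) (a : ℝ) (x y : E) : ℝ :=
  open Classical in if x ≠ y ∧ g x y ≠ a then 1 else 0

theorem indA_nonneg (g : E → E → ℝ) (a : ℝ) (x y : E) : 0 ≤ indA g a x y := by
  unfold indA; split_ifs <;> simp

theorem indB_nonneg (g : E → E → ℝ) (a : ℝ) (x y : E) : 0 ≤ indB g a x y := by
  unfold indB; split_ifs <;> simp

variable {M : Type*} [AddCommGroup M] [Module ℝ M] {C : Finset E} {g : E → E → ℝ} {a b : ℝ}

/-- A sum over pairs, grouped by inner products. -/
theorem sum_pairs (hd : ∀ x ∈ C, g x x = 1)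
    (hab : ∀ x ∈ C, ∀ y ∈ C, x ≠ y → g x y = a ∨ g x y = b) (f : ℝ → M) :
    ∑ x ∈ C, ∑ y ∈ C, f (g x y) = (C.card : ℝ) • f 1
      + (∑ x ∈ C, ∑ y ∈ C, indA g a x y) • f a + (∑ x ∈ C, ∑ y ∈ C, indB g a x y) • f b := by
  have key : ∀ x ∈ C, ∀ y ∈ C, f (g x y) = (if x = y then (1 : ℝ) else 0) • f 1
      + indA g a x y • f a + indB g a x y • f b := by
    intro x hx y hy
    unfold indA indB
    by_cases hxy : x = y
    · subst hxy
      simp [hd x hx]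
    · by_cases h : g x y = a
      · simp [hxy, h]
      · simp [hxy, (hab x hx y hy hxy).resolve_left h]
        simp [← (hab x hx y hy hxy).resolve_left h, h]
  rw [Finset.sum_congr rfl fun x hx => Finset.sum_congr rfl fun y hy => key x hx y hy]
  simp only [Finset.sum_add_distrib, ← Finset.sum_smul]
  congr 3
  simp

/-- A sum over triples, grouped by inner products. -/
theorem sum_triples (hd : ∀ x ∈ C, g x x = 1) (hg : ∀ x y, g x y = g y x)
    (hab : ∀ x ∈ C, ∀ y ∈ C, x ≠ y → g x y = a ∨ g x y = b) (f : ℝ → ℝ → ℝ → M)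
    (hf : ∀ u v t, f u v t = f v u t) (hf' : ∀ u v t, f u v t = f u t v) :
    ∑ x ∈ C, ∑ y ∈ C, ∑ z ∈ C, f (g x y) (g x z) (g y z) = (C.card : ℝ) • f 1 1 1
      + (3 * ∑ x ∈ C, ∑ y ∈ C, indA g a x y) • f a a 1
      + (3 * ∑ x ∈ C, ∑ y ∈ C, indB g a x y) • f b b 1
      + (∑ x ∈ C, ∑ y ∈ C, ∑ z ∈ C, indA g a x y * indA g a x z * indA g a y z) • f a a a
      + (∑ x ∈ C, ∑ y ∈ C, ∑ z ∈ C, (indA g a x y * indA g a x z * indB g a y z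
        + indA g a x y * indB g a x z * indA g a y z
        + indB g a x y * indA g a x z * indA g a y z)) • f a a b
      + (∑ x ∈ C, ∑ y ∈ C, ∑ z ∈ C, (indA g a x y * indB g a x z * indB g a y z
        + indB g a x y * indA g a x z * indB g a y z
        + indB g a x y * indB g a x z * indA g a y z)) • f a b b
      + (∑ x ∈ C, ∑ y ∈ C, ∑ z ∈ C, indB g a x y * indB g a x z * indB g a y z) • f b b b := by
  have key : ∀ x ∈ C, ∀ y ∈ C, ∀ z ∈ C, f (g x y) (g x z) (g y z)
      = ((if x = y then (1 : ℝ) else 0) * (if x = z then (1 : ℝ) else 0)) • f 1 1 1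
      + ((if x = y then (1 : ℝ) else 0) * indA g a x z
        + (if x = z then (1 : ℝ) else 0) * indA g a x y
        + (if y = z then (1 : ℝ) else 0) * indA g a x y) • f a a 1
      + ((if x = y then (1 : ℝ) else 0) * indB g a x z
        + (if x = z then (1 : ℝ) else 0) * indB g a x y
        + (if y = z then (1 : ℝ) else 0) * indB g a x y) • f b b 1
      + (indA g a x y * indA g a x z * indA g a y z) • f a a a
      + (indA g a x y * indA g a x z * indB g a y z
        + indA g a x y * indB g a x z * indA g a y z
        + indB g a x y * indA g a x z * indA g a y z) • f a a b
      + (indA g a x y * indB g a x z * indB g a y z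
        + indB g a x y * indA g a x z * indB g a y z
        + indB g a x y * indB g a x z * indA g a y z) • f a b b
      + (indB g a x y * indB g a x z * indB g a y z) • f b b b := by
    intro x hx y hy z hz
    have hself (w : E) : indA g a w w = 0 ∧ indB g a w w = 0 := by simp [indA, indB]
    have hdich : ∀ v ∈ C, ∀ w ∈ C, v ≠ w →
        (g v w = a ∧ indA g a v w = 1 ∧ indB g a v w = 0) ∨
        (g v w = b ∧ indA g a v w = 0 ∧ indB g a v w = 1) := by
      intro v hv w hw hvw
      by_cases h : g v w = a
      · exact Or.inl (by simp [indA, indB, hvw, h])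
      · exact Or.inr ⟨(hab v hv w hw hvw).resolve_left h, by simp [indA, indB, hvw, h]⟩
    by_cases hxy : x = y
    · subst hxy
      by_cases hxz : x = z
      · subst hxz
        simp [hself, hd x hx]
      · rcases hdich x hx z hz hxz with ⟨h1, h2, h3⟩ | ⟨h1, h2, h3⟩
        · simp [hself, hd x hx, h1, h2, h3, hxz, hf 1 a a, hf' a 1 a]
        · simp [hself, hd x hx, h1, h2, h3, hxz, hf 1 b b, hf' b 1 b]
    · by_cases hxz : x = z
      · subst hxz
        have hyx : y ≠ x := Ne.symm hxy
        rcases hdich x hx y hy hxy with ⟨h1, h2, h3⟩ | ⟨h1, h2, h3⟩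
        · simp [hself, hd x hx, hg y x, h1, h2, h3, hxy, hyx, hf' a 1 a]
        · simp [hself, hd x hx, hg y x, h1, h2, h3, hxy, hyx, hf' b 1 b]
      · by_cases hyz : y = z
        · subst hyz
          rcases hdich x hx y hy hxy with ⟨h1, h2, h3⟩ | ⟨h1, h2, h3⟩
          · simp [hself, hd y hy, h1, h2, h3, hxy]
          · simp [hself, hd y hy, h1, h2, h3, hxy]
        · rcases hdich x hx y hy hxy with ⟨h1, h2, h3⟩ | ⟨h1, h2, h3⟩ <;>
          rcases hdich x hx z hz hxz with ⟨h4, h5, h6⟩ | ⟨h4, h5, h6⟩ <;>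
          rcases hdich y hy z hz hyz with ⟨h7, h8, h9⟩ | ⟨h7, h8, h9⟩ <;>
          simp [h1, h2, h3, h4, h5, h6, h7, h8, h9, hxy, hxz, hyz, hf' a b a, hf b a a,
            hf b a b, hf' b b a]
  rw [Finset.sum_congr rfl fun x hx => Finset.sum_congr rfl fun y hy =>
    Finset.sum_congr rfl fun z hz => key x hx y hy z hz]
  have e0 : ∑ x ∈ C, ∑ y ∈ C, ∑ z ∈ C,
      (if x = y then (1 : ℝ) else 0) * (if x = z then (1 : ℝ) else 0) = C.card := by
    simp
  -- Each coincidence x = y, x = z or y = z reproduces the pair sum once, whence the factor 3.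
  have e1 (w : E → E → ℝ) : ∑ x ∈ C, ∑ y ∈ C, ∑ z ∈ C, ((if x = y then (1 : ℝ) else 0) * w x z
      + (if x = z then (1 : ℝ) else 0) * w x y + (if y = z then (1 : ℝ) else 0) * w x y)
        = 3 * ∑ x ∈ C, ∑ y ∈ C, w x y := by
    have h1 : ∑ x ∈ C, ∑ y ∈ C, ∑ z ∈ C, (if x = y then (1 : ℝ) else 0) * w x z
        = ∑ x ∈ C, ∑ y ∈ C, w x y := by
      refine Finset.sum_congr rfl fun x hx => ?_
      simp only [← Finset.mul_sum, ← Finset.sum_mul]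
      simp [hx]
    have h2 : ∑ x ∈ C, ∑ y ∈ C, ∑ z ∈ C, (if x = z then (1 : ℝ) else 0) * w x y
        = ∑ x ∈ C, ∑ y ∈ C, w x y := by
      refine Finset.sum_congr rfl fun x hx => Finset.sum_congr rfl fun y _ => ?_
      simp [hx]
    have h3 : ∑ x ∈ C, ∑ y ∈ C, ∑ z ∈ C, (if y = z then (1 : ℝ) else 0) * w x y
        = ∑ x ∈ C, ∑ y ∈ C, w x y := by
      refine Finset.sum_congr rfl fun x _ => Finset.sum_congr rfl fun y hy => ?_
      simp [hy]
    simp only [Finset.sum_add_distrib, h1, h2, h3]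
    ring
  rw [← e0, ← e1, ← e1]
  simp only [Finset.sum_add_distrib, ← Finset.sum_smul]

end Counting

/-! ### Feasible points. -/

theorem le_sdpValue {n p : ℕ} {a b : ℝ} {x : Fin 6 → ℝ} (hx : Feasible n p a b x) {c : ℝ}
    (hc : c = 1 + (1 / 3) * (x 0 + x 1)) : (c : EReal) ≤ sdpValue n p a b := by
  rw [hc]
  exact le_iSup₂_of_le x hx le_rfl

theorem posSemidef_two (s : ℝ) : (!![1, s; s, s ^ 2] : Matrix (Fin 2) (Fin 2) ℝ).PosSemidef := by
  have h : (!![1, s; s, s ^ 2] : Matrix (Fin 2) (Fin 2) ℝ)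
      = Matrix.vecMulVec ![1, s] (star ![1, s]) := by
    ext i j
    fin_cases i <;> fin_cases j <;> simp [Matrix.vecMulVec_apply, sq]
  rw [h]
  exact Matrix.posSemidef_vecMulVec_self_star _

theorem homGegenbauer_zero_zero (m k : ℕ) : homGegenbauer m (k + 1) 0 0 = 0 := by
  cases k <;> simp [homGegenbauer]

/-- Here t - uv and (1 - u²)(1 - v²) both vanish, which leaves the all-ones matrix for k = 0 and
zero for k > 0. -/
theorem matS_one_posSemidef (n p k : ℕ) : (matS n p k 1 1 1).PosSemidef := by
  have h : matS n p k 1 1 1 = homGegenbauer (n - 1) k 0 0 •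
      Matrix.vecMulVec (fun _ => 1) (star fun _ => 1) := by
    rw [matS_eq]
    ext i j
    simp [matY, Matrix.vecMulVec_apply]
    ring
  rw [h]
  refine (Matrix.posSemidef_vecMulVec_self_star _).smul ?_
  cases k with
  | zero => simp [homGegenbauer]
  | succ k => rw [homGegenbauer_zero_zero]

/-- Serves the empty `C`, where dividing by the cardinality is meaningless; the objective here is 1.
-/
theorem feasible_zero (n p : ℕ) (a b : ℝ) : Feasible n p a b 0 where
  nonneg _ := le_rfl
  psd_two := by
    convert posSemidef_two 0 using 1
    ext i j
    fin_cases i <;> fin_cases j <;> simp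
  linear i _ := by simp
  psd_S i _ := by simpa using matS_one_posSemidef n p i

theorem sum_gegenbauer_nonneg {n : ℕ} (hn : 2 ≤ n) (k : ℕ) {C : Finset (EuclideanSpace ℝ (Fin n))}
    (hunit : ∀ x ∈ C, ‖x‖ = 1) : 0 ≤ ∑ x ∈ C, ∑ y ∈ C, gegenbauer n k (inner ℝ x y) := by
  have h := sum_homGegenbauer_nonneg (E := EuclideanSpace ℝ (Fin n)) (by simpa using hn) k C
    (fun _ => 1) id
  refine h.trans_eq (Finset.sum_congr rfl fun x hx => Finset.sum_congr rfl fun y hy => ?_)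
  simp [hunit x hx, hunit y hy, homGegenbauer_one_right]

/-- The feasible point given by the normalised pair and triple counts of a two-distance set. -/
theorem exists_feasible {n : ℕ} (hn : 3 ≤ n) (p : ℕ) {a b : ℝ}
    {C : Finset (EuclideanSpace ℝ (Fin n))} (hC : C.Nonempty) (hunit : ∀ x ∈ C, ‖x‖ = 1)
    (hab : ∀ x ∈ C, ∀ y ∈ C, x ≠ y → inner ℝ x y = a ∨ inner ℝ x y = b) :
    ∃ x, Feasible n p a b x ∧ (C.card : ℝ) = 1 + (1 / 3) * (x 0 + x 1) := by
  classical
  set g : EuclideanSpace ℝ (Fin n) → EuclideanSpace ℝ (Fin n) → ℝ := fun x y => inner ℝ x y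
    with hg_def
  have hg (x y) : g x y = g y x := real_inner_comm y x
  have hd : ∀ x ∈ C, g x x = 1 := fun x hx => by
    simp [hg_def, hunit x hx]
  have hN : (0 : ℝ) < C.card := by exact_mod_cast hC.card_pos
  have hpair := fun f : ℝ → ℝ => sum_pairs (C := C) (g := g) (a := a) (b := b) hd hab f
  have htriple := fun f : ℝ → ℝ → ℝ → ℝ =>
    sum_triples (C := C) (g := g) (a := a) (b := b) hd hg hab f
  have hmat := fun k => sum_triples (C := C) (g := g) (a := a) (b := b) hd hg hab (matS n p k)
    (matS_swap_left n p k) (matS_swap_right n p k)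
  have hA := indA_nonneg g a
  have hB := indB_nonneg g a
  have hA0 : 0 ≤ ∑ x ∈ C, ∑ y ∈ C, indA g a x y :=
    Finset.sum_nonneg fun x _ => Finset.sum_nonneg fun y _ => hA x y
  have hB0 : 0 ≤ ∑ x ∈ C, ∑ y ∈ C, indB g a x y :=
    Finset.sum_nonneg fun x _ => Finset.sum_nonneg fun y _ => hB x y
  have h30 : 0 ≤ ∑ x ∈ C, ∑ y ∈ C, ∑ z ∈ C, indA g a x y * indA g a x z * indA g a y z :=
    Finset.sum_nonneg fun x _ => Finset.sum_nonneg fun y _ => Finset.sum_nonneg fun z _ => by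
      have := hA x y; have := hA x z; have := hA y z
      positivity
  have h40 : 0 ≤ ∑ x ∈ C, ∑ y ∈ C, ∑ z ∈ C, (indA g a x y * indA g a x z * indB g a y z
        + indA g a x y * indB g a x z * indA g a y z
        + indB g a x y * indA g a x z * indA g a y z) :=
    Finset.sum_nonneg fun x _ => Finset.sum_nonneg fun y _ => Finset.sum_nonneg fun z _ => by
      have := hA x y; have := hA x z; have := hA y z
      have := hB x y; have := hB x z; have := hB y z
      positivity
  have h50 : 0 ≤ ∑ x ∈ C, ∑ y ∈ C, ∑ z ∈ C, (indA g a x y * indB g a x z * indB g a y z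
        + indB g a x y * indA g a x z * indB g a y z
        + indB g a x y * indB g a x z * indA g a y z) :=
    Finset.sum_nonneg fun x _ => Finset.sum_nonneg fun y _ => Finset.sum_nonneg fun z _ => by
      have := hA x y; have := hA x z; have := hA y z
      have := hB x y; have := hB x z; have := hB y z
      positivity
  have h60 : 0 ≤ ∑ x ∈ C, ∑ y ∈ C, ∑ z ∈ C, indB g a x y * indB g a x z * indB g a y z :=
    Finset.sum_nonneg fun x _ => Finset.sum_nonneg fun y _ => Finset.sum_nonneg fun z _ => by
      have := hB x y; have := hB x z; have := hB y z
      positivity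
  generalize ∑ x ∈ C, ∑ y ∈ C, indA g a x y = A at *
  generalize ∑ x ∈ C, ∑ y ∈ C, indB g a x y = B at *
  generalize ∑ x ∈ C, ∑ y ∈ C, ∑ z ∈ C, indA g a x y * indA g a x z * indA g a y z = T₃ at *
  generalize ∑ x ∈ C, ∑ y ∈ C, ∑ z ∈ C, (indA g a x y * indA g a x z * indB g a y z
        + indA g a x y * indB g a x z * indA g a y z
        + indB g a x y * indA g a x z * indA g a y z) = T₄ at *
  generalize ∑ x ∈ C, ∑ y ∈ C, ∑ z ∈ C, (indA g a x y * indB g a x z * indB g a y z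
        + indB g a x y * indA g a x z * indB g a y z
        + indB g a x y * indB g a x z * indA g a y z) = T₅ at *
  generalize ∑ x ∈ C, ∑ y ∈ C, ∑ z ∈ C, indB g a x y * indB g a x z * indB g a y z = T₆ at *
  -- Constant functions in the grouped sums count all N² pairs and, below, all N³ triples.
  have hp1 : A + B = C.card * (C.card - 1) := by
    have h := hpair fun _ => 1
    simp at h
    linarith
  have ht1 : T₃ + T₄ + T₅ + T₆ = C.card * (C.card - 1) * (C.card - 2) := by
    have h := htriple (fun _ _ _ => 1) (fun _ _ _ => rfl) (fun _ _ _ => rfl)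
    simp at h
    linarith
  generalize hNdef : (C.card : ℝ) = N at *
  have e1 : 1 / 3 * (3 * A / N + 3 * B / N) = N - 1 := by
    field_simp
    linarith
  have e2 : T₃ / N + T₄ / N + T₅ / N + T₆ / N = (N - 1) * (N - 2) := by
    field_simp
    linarith
  -- These are the coefficients in `sum_triples` divided by N, which makes that of `f 1 1 1` equal
  -- to 1.
  refine ⟨![3 * A / N, 3 * B / N, T₃ / N, T₄ / N, T₅ / N, T₆ / N], ⟨?_, ?_, ?_, ?_⟩, ?_⟩
  · intro j
    fin_cases j <;> simp <;> positivity
  -- The corner entry is (N - 1) + (N - 1)(N - 2) = (N - 1)².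
  · convert posSemidef_two (N - 1) using 1
    ext i j
    fin_cases i <;> fin_cases j <;> simp
    · linarith
    · linarith
    · linear_combination e1 + e2
  · intro i _
    have h := sum_gegenbauer_nonneg (by omega : 2 ≤ n) i hunit
    have h' := hpair (gegenbauer n i)
    rw [gegenbauer_one (by omega)] at h'
    have e : 3 + gegenbauer n i a * (3 * A / N) + gegenbauer n i b * (3 * B / N)
        = 3 / N * ∑ x ∈ C, ∑ y ∈ C, gegenbauer n i (g x y) := by
      rw [h']
      simp only [smul_eq_mul]
      field_simp
    simp only [Matrix.cons_val]
    rw [e]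
    positivity
  · intro i _
    have h := (sum_matS_posSemidef hn p i hunit).smul (inv_nonneg.2 hN.le)
    convert h using 1
    refine Eq.trans ?_ (congrArg (N⁻¹ • ·) (hmat i)).symm
    simp only [Matrix.cons_val]
    match_scalars <;> field_simp
  · simp only [Matrix.cons_val]
    linarith

end TwoDistanceSDP

theorem mainTheorem2 (n : ℕ) (hn : 3 ≤ n) (p : ℕ) (hp : 0 < p) (a b : ℝ)
    (C : Finset (EuclideanSpace ℝ (Fin n)))
    (hunit : ∀ x ∈ C, ‖x‖ = 1)
    (hab : ∀ x ∈ C, ∀ y ∈ C, x ≠ y → inner ℝ x y = a ∨ inner ℝ x y = b) :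
    ((C.card : ℝ) : EReal) ≤ TwoDistanceSDP.sdpValue n p a b := by
  rcases C.eq_empty_or_nonempty with rfl | hC
  · refine le_trans ?_ (TwoDistanceSDP.le_sdpValue (TwoDistanceSDP.feasible_zero n p a b) rfl)
    simp
  · obtain ⟨x, hx, h⟩ := TwoDistanceSDP.exists_feasible hn p hC hunit hab
    exact TwoDistanceSDP.le_sdpValue hx h
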